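/- **Definitions.** Let $|\cdot|$ denote the diameter. For $E\subset\mathbb R^d$ and $0\le\theta\le1$ the lower and upper $\theta$-intermediate dimensions of $E$ are $$\underline{\dim}_\theta E=\inf\{s\ge0:\ \forall\varepsilon>0\ \forall\Delta>0\ \exists\,0<\delta\le\Delta\text{ and a cover }\{U_i\}\text{ of }E\text{ with }\delta^{1/\theta}\le|U_i|\le\delta,\ \textstyle\sum|U_i|^s\le\varepsilon\},$$ $$\overline{\dim}_\theta E=\inf\{s\ge0:\ \forall\varepsilon>0\ \exists\Delta>0\ \forall\,0<\delta\le\Delta\ \text{there is a cover }\{U_i\}\text{ of }E\text{ with }\delta^{1/\theta}\le|U_i|\le\delta,\ \textstyle\sum|U_i|^s\le\varepsilon\},$$ where covers are finite or countable and $\delta^{1/\theta}$ is read as $0$ when $\theta=0$. Let $n_k\ge2$ $(k\ge1)$ be integers, $c_{k,i}>0$ $(1\le i\le n_k)$ reals with $\sum_{i=1}^{n_k}c_{k,i}^d\le1$ for all $k$, and $J\subset\mathbb R^d$ a compact set with non-empty interior. Let $\Sigma^k$ be the set of words $u_1\cdots u_k$ with $1\le u_j\le n_j$. Let $J_{\mathbf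 u}$ ($\mathbf u\in\bigcup_{k\ge0}\Sigma^k$) be sets with $J_\emptyset=J$ such that each $J_{\mathbf u}$ is the image of $J$ under a similarity of $\mathbb R^d$ and, for all $k\ge1$ and $\mathbf u\in\Sigma^{k-1}$, the sets $J_{\mathbf u1},\dots,J_{\mathbf un_k}$ are subsets of $J_{\mathbf u}$ with pairwise disjoint interiors and $|J_{\mathbf ui}|/|J_{\mathbf u}|=c_{k,i}$. Then $E=\bigcap_{k\ge1}\bigcup_{\mathbf u\in\Sigma^k}J_{\mathbf u}$ is called a Moran set; it is a homogeneous Moran set if, for each $k$, the ratios $c_{k,1},\dots,c_{k,n_k}$ are all equal. **Proposition.** Let $d\ge1$ and $L\ge2$ be integers, and let $f(\theta)=\dfrac{La\theta+b}{Lc\theta+c}$ with $a,b,c\in\mathbb R$, $c>a\ge b>0$ and $\dfrac ab\in\mathbb N$. Then there exists a homogeneous Moran set $E\subset\mathbb R^d$ such that $$\overline{\dim}_\theta E=\begin{cases}f(\theta),&\theta\in[\tfrac1{L^2},1],\\ \dim_H E,&\theta\in[0,\tfrac1{L^2}],\end{cases}$$ and $\underline{\dim}_\theta E=\dim_H E$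 for all $\theta\in[0,1]$, where $\dim_H$ is the Hausdorff dimension. -/

import Mathlib

open Set
open scoped ENNReal NNReal

noncomputable section

/-! ### Intermediate dimensions -/

/-- The smallest diameter `δ ^ (1 / θ)` allowed in a cover, where for `θ = 0` the exponent
`1 / θ` is read as `∞`, so that (for small `δ`) there is no lower restriction. -/
def lowerScale (θ δ : ℝ) : ℝ := if θ = 0 then 0 else δ ^ (1 / θ)

/-- There is a countable (possibly finite) cover `𝒰` of `E` by sets `U` with
`δ ^ (1 / θ) ≤ |U| ≤ δ` and `∑ |U| ^ s ≤ ε`. Diameters and the sum are taken in `[0, ∞]`. -/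
def HasIntermediateCover {X : Type*} [PseudoEMetricSpace X]
    (E : Set X) (θ : ℝ) (s : ℝ≥0) (ε δ : ℝ) : Prop :=
  ∃ 𝒰 : Set (Set X), 𝒰.Countable ∧ E ⊆ ⋃₀ 𝒰 ∧
    (∀ U ∈ 𝒰, ENNReal.ofReal (lowerScale θ δ) ≤ Metric.ediam U ∧
      Metric.ediam U ≤ ENNReal.ofReal δ) ∧
    ∑' U : 𝒰, Metric.ediam (U : Set X) ^ (s : ℝ) ≤ ENNReal.ofReal ε

/-- The lower `θ`-intermediate dimension, as an element of `[0, ∞]` (the infimum of the empty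
set is `∞`). -/
def lowerIntermediateDim {X : Type*} [PseudoEMetricSpace X] (θ : ℝ) (E : Set X) : ℝ≥0∞ :=
  sInf ((fun s : ℝ≥0 => (s : ℝ≥0∞)) '' {s : ℝ≥0 | ∀ ε : ℝ, 0 < ε → ∀ Δ : ℝ, 0 < Δ →
    ∃ δ : ℝ, 0 < δ ∧ δ ≤ Δ ∧ HasIntermediateCover E θ s ε δ})

/-- The upper `θ`-intermediate dimension, as an element of `[0, ∞]`. -/
def upperIntermediateDim {X : Type*} [PseudoEMetricSpace X] (θ : ℝ) (E : Set X) : ℝ≥0∞ :=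
  sInf ((fun s : ℝ≥0 => (s : ℝ≥0∞)) '' {s : ℝ≥0 | ∀ ε : ℝ, 0 < ε → ∃ Δ : ℝ, 0 < Δ ∧
    ∀ δ : ℝ, 0 < δ → δ ≤ Δ → HasIntermediateCover E θ s ε δ})

/-! ### Moran sets -/

/-- Words of length `k`; the letter in position `j` (counted from `0`) ranges over `n j`
symbols. -/
abbrev MoranWord (n : ℕ → ℕ) (k : ℕ) : Type := (j : Fin k) → Fin (n j)

/-- The word `u i` obtained by appending the letter `i` to the word `u`. -/
def MoranWord.append {n : ℕ → ℕ} {k : ℕ} (u : MoranWord n k) (i : Fin (n k)) :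
    MoranWord n (k + 1) :=
  Fin.snoc (α := fun j : Fin (k + 1) => Fin (n j)) u i

/-- A Moran structure in `ℝ^d`. Levels are counted from `0`: `n k` and `ratio k` are the number
of children and the vector of contraction ratios used in passing from the `k`-th level basic
sets to the `(k + 1)`-st level ones. -/
structure MoranStructure (d : ℕ) where
  n : ℕ → ℕ
  two_le_n : ∀ k, 2 ≤ n k
  ratio : (k : ℕ) → Fin (n k) → ℝ
  ratio_pos : ∀ k i, 0 < ratio k i
  sum_ratio_pow_le_one : ∀ k, ∑ i, ratio k i ^ d ≤ 1
  J : Set (EuclideanSpace ℝ (Fin d))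
  isCompact_J : IsCompact J
  interior_J_nonempty : (interior J).Nonempty
  /-- The basic sets `J_u`. -/
  basicSet : (k : ℕ) → MoranWord n k → Set (EuclideanSpace ℝ (Fin d))
  basicSet_zero : ∀ u : MoranWord n 0, basicSet 0 u = J
  /-- Every basic set is the image of `J` under a similarity. -/
  exists_similarity : ∀ (k : ℕ) (u : MoranWord n k),
    ∃ Ψ : EuclideanSpace ℝ (Fin d) →ᵈ EuclideanSpace ℝ (Fin d), basicSet k u = Ψ '' J
  basicSet_append_subset : ∀ (k : ℕ) (u : MoranWord n k) (i : Fin (n k)),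
    basicSet (k + 1) (u.append i) ⊆ basicSet k u
  disjoint_interior : ∀ (k : ℕ) (u : MoranWord n k) (i i' : Fin (n k)), i ≠ i' →
    interior (basicSet (k + 1) (u.append i)) ∩ interior (basicSet (k + 1) (u.append i')) = ∅
  diam_div_diam : ∀ (k : ℕ) (u : MoranWord n k) (i : Fin (n k)),
    Metric.diam (basicSet (k + 1) (u.append i)) / Metric.diam (basicSet k u) = ratio k i

/-- The Moran set `⋂_{k ≥ 1} ⋃_{u ∈ Σ^k} J_u`. -/
def MoranStructure.limitSet {d : ℕ} (S : MoranStructure d) : Set (EuclideanSpace ℝ (Fin d)) :=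
  ⋂ k : ℕ, ⋃ u : MoranWord S.n (k + 1), S.basicSet (k + 1) u

/-- At each level all the contraction ratios coincide. -/
def MoranStructure.IsHomogeneous {d : ℕ} (S : MoranStructure d) : Prop :=
  ∀ k : ℕ, ∃ c : ℝ, ∀ i : Fin (S.n k), S.ratio k i = c

/-- `E ⊆ ℝ^d` is a homogeneous Moran set. -/
def IsHomogeneousMoranSet {d : ℕ} (E : Set (EuclideanSpace ℝ (Fin d))) : Prop :=
  ∃ S : MoranStructure d, S.IsHomogeneous ∧ E = S.limitSet

/-- The family of Möbius functions `θ ↦ (L a θ + b) / (L c θ + c)` with `c > a ≥ b > 0` and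
`a / b` a natural number. -/
def moebiusFamily (L : ℕ) : Set (ℝ → ℝ) :=
  {f | ∃ a b c : ℝ, a < c ∧ b ≤ a ∧ 0 < b ∧ (∃ m : ℕ, a / b = m) ∧
    f = fun θ => (L * a * θ + b) / (L * c * θ + c)}

end

open MeasureTheory Metric Filter Topology

noncomputable section

/-! ### Homogeneous Moran sets along an axis -/

/-! Put m = a/b and T = c/b. Take a Cantor set on a line with 2^G(k) separated balls of radius ρ^k
at level k, where ρ = 2^(-T) and G is `blockSum`. Covering at level y costs about 2^(G(y) - T s y),
and the uniform mass shows that this is optimal up to constants. Diameters in [δ^(1/θ), δ]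
correspond to levels in a window [k, k/θ]. Hence the upper dimension is 1/T times the limsup over k
of the minimum of G(y)/y on the window, while the lower and Hausdorff dimensions are 1/T times the
liminf of G(y)/y.

The increments of G alternate between m and 1 on the blocks [L^i, L^(i+1)). Around p = L^(2j+1), up
to a bounded error in G, the ratio G(y)/y is m - (m-1)p/((L+1)y) before p and 1 + L(m-1)p/((L+1)y)
after p: it rises, then falls. The worst window has equal ratios at its two ends, which forces k =
p(1+Lθ)/(L+1) and gives the value (Lmθ+1)/(Lθ+1), that is `blockExponent`; dividing by T gives f(θ).
At θ = 1/L² this window is the full period [L^(2j), L^(2j+2)]. For smaller θ every window contains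
an even power of L, where G(y)/y is lowest up to a vanishing error, so the upper dimension drops to
the Hausdorff dimension.

The arithmetic is in `le_blockSum_of_mem` and `exists_blockSum_le`; `HasGrowth` carries it over to
dimensions. -/

theorem sum_const_ratio_pow_le_one {ρ β : ℝ} {n d : ℕ} (hd : 1 ≤ d) (hρ : 0 < ρ) (hβ : 2 * ρ < β)
    (hn2 : 2 ≤ n) (hn : ((n : ℝ) - 1) * β ≤ 2 * (1 - ρ)) :
    ∑ _i : Fin n, ρ ^ d ≤ 1 := by
  have h2 : (2 : ℝ) ≤ n := by exact_mod_cast hn2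
  have h1 : (n : ℝ) * ρ ≤ 1 := by nlinarith
  have hρ1 : ρ ≤ 1 := by nlinarith
  have := pow_le_pow_of_le_one hρ.le hρ1 hd
  rw [pow_one] at this
  simp only [Finset.sum_const, Finset.card_univ, Fintype.card_fin, nsmul_eq_mul]
  nlinarith

/-- The centre, on the first coordinate axis, of the basic set of a word. -/
def wordCenter (ρ β : ℝ) {n : ℕ → ℕ} {k : ℕ} (u : MoranWord n k) : ℝ :=
  ∑ j : Fin k, ρ ^ (j : ℕ) * (β * ((u j : ℕ) : ℝ) - (1 - ρ))

theorem wordCenter_append (ρ β : ℝ) {n : ℕ → ℕ} {k : ℕ} (u : MoranWord n k) (i : Fin (n k)) :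
    wordCenter ρ β (u.append i) = wordCenter ρ β u + ρ ^ k * (β * ((i : ℕ) : ℝ) - (1 - ρ)) := by
  unfold wordCenter MoranWord.append
  rw [Fin.sum_univ_castSucc]
  congr 1
  · refine Finset.sum_congr rfl fun j _ => ?_
    rw [Fin.snoc_castSucc (α := fun j : Fin (k + 1) => Fin (n j))]
    rfl
  · rw [Fin.snoc_last (α := fun j : Fin (k + 1) => Fin (n j))]
    rfl

/-- The unit vector of the first coordinate axis. -/
def axisVector {d : ℕ} (hd : 1 ≤ d) : EuclideanSpace ℝ (Fin d) :=
  EuclideanSpace.single (⟨0, hd⟩ : Fin d) 1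

theorem dist_smul_axisVector {d : ℕ} (hd : 1 ≤ d) (s t : ℝ) :
    dist (s • axisVector hd) (t • axisVector hd) = |s - t| := by
  rw [dist_eq_norm, ← sub_smul, norm_smul, axisVector, PiLp.norm_single]
  simp

/-- The leftmost child touches its parent's sphere from inside, at relative offset -(1-ρ). The bound
on n keeps the last child within 1-ρ on the other side, so all children stay inside the parent. -/
theorem abs_offset_le {ρ β : ℝ} {n : ℕ} (hβ : 0 ≤ β) (hn : ((n : ℝ) - 1) * β ≤ 2 * (1 - ρ))
    (i : Fin n) : |β * ((i : ℕ) : ℝ) - (1 - ρ)| ≤ 1 - ρ := by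
  have hi : ((i : ℕ) : ℝ) + 1 ≤ n := by exact_mod_cast i.2
  have h0 : (0 : ℝ) ≤ (i : ℕ) := by positivity
  rw [abs_le]
  constructor <;> nlinarith [mul_nonneg hβ h0, mul_le_mul_of_nonneg_left hi hβ]

theorem le_abs_offset_sub {β : ℝ} {n : ℕ} (hβ : 0 ≤ β) {i i' : Fin n} (h : i ≠ i') :
    β ≤ |β * ((i : ℕ) : ℝ) - β * ((i' : ℕ) : ℝ)| := by
  have hne : ((i : ℕ) : ℤ) - ((i' : ℕ) : ℤ) ≠ 0 := by
    intro h0; exact h (Fin.ext (by omega))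
  have h1 : (1 : ℝ) ≤ |((i : ℕ) : ℝ) - ((i' : ℕ) : ℝ)| := by
    have := Int.one_le_abs hne
    exact_mod_cast this
  rw [← mul_sub, abs_mul, abs_of_nonneg hβ]
  nlinarith

/-- The homogeneous Moran structure generated by the unit ball: the children of a ball are balls
centred on the first coordinate axis, with relative size `ρ` and spacing `β`. -/
def axisMoran {d : ℕ} (hd : 1 ≤ d) {ρ β : ℝ} (hρ : 0 < ρ) (hβ : 2 * ρ < β) {n : ℕ → ℕ}
    (hn2 : ∀ k, 2 ≤ n k) (hn : ∀ k, ((n k : ℝ) - 1) * β ≤ 2 * (1 - ρ)) : MoranStructure d where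
  n := n
  two_le_n := hn2
  ratio _ _ := ρ
  ratio_pos _ _ := hρ
  sum_ratio_pow_le_one k := sum_const_ratio_pow_le_one hd hρ hβ (hn2 k) (hn k)
  J := closedBall 0 1
  isCompact_J := isCompact_closedBall 0 1
  interior_J_nonempty := by
    rw [interior_closedBall _ one_ne_zero]
    exact ⟨0, mem_ball_self one_pos⟩
  basicSet k u := closedBall (wordCenter ρ β u • axisVector hd) (ρ ^ k)
  basicSet_zero u := by simp [wordCenter]
  exists_similarity k u := by
    refine ⟨(DilationEquiv.smulTorsor (wordCenter ρ β u • axisVector hd)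
      (pow_pos hρ k).ne').toDilation, ?_⟩
    rw [← affinity_unitClosedBall (pow_pos hρ k).le]
    ext x
    simp only [mem_vadd_set, mem_smul_set, mem_image, exists_exists_and_eq_and]
    refine exists_congr fun y => and_congr_right fun _ => ?_
    change _ ↔ ρ ^ k • y +ᵥ wordCenter ρ β u • axisVector hd = x
    rw [vadd_eq_add, vadd_eq_add, add_comm]
  basicSet_append_subset k u i := by
    apply closedBall_subset_closedBall'
    rw [dist_smul_axisVector, wordCenter_append, add_sub_cancel_left, abs_mul,
      abs_of_pos (pow_pos hρ k), pow_succ]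
    nlinarith [abs_offset_le (by linarith : 0 ≤ β) (hn k) i, pow_pos hρ k]
  disjoint_interior k u i i' h := by
    rw [interior_closedBall _ (pow_pos hρ _).ne', interior_closedBall _ (pow_pos hρ _).ne']
    refine (ball_disjoint_ball ?_).inter_eq
    rw [dist_smul_axisVector, wordCenter_append, wordCenter_append, add_sub_add_left_eq_sub,
      ← mul_sub, sub_sub_sub_cancel_right, abs_mul, abs_of_pos (pow_pos hρ k), pow_succ]
    nlinarith [le_abs_offset_sub (by linarith : 0 ≤ β) h, pow_pos hρ k]
  diam_div_diam k u i := by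
    have : Nonempty (Fin d) := ⟨⟨0, hd⟩⟩
    rw [diam_closedBall_eq _ (pow_pos hρ _).le, diam_closedBall_eq _ (pow_pos hρ _).le, pow_succ]
    have := (pow_pos hρ k).ne'
    field_simp

/-- Centres of distinct siblings are at least β ρ^k apart and the radii are ρ^(k+1). This separation
lets a set of small diameter see only one cylinder. -/
theorem gap_le_dist {d : ℕ} (hd : 1 ≤ d) {ρ β : ℝ} (hρ : 0 < ρ) (hβ : 2 * ρ < β)
    {n : ℕ → ℕ} {k : ℕ} (u : MoranWord n k) {i i' : Fin (n k)} (h : i ≠ i')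
    {x y : EuclideanSpace ℝ (Fin d)}
    (hx : x ∈ closedBall (wordCenter ρ β (u.append i) • axisVector hd) (ρ ^ (k + 1)))
    (hy : y ∈ closedBall (wordCenter ρ β (u.append i') • axisVector hd) (ρ ^ (k + 1))) :
    (β - 2 * ρ) * ρ ^ k ≤ dist x y := by
  have h1 := dist_smul_axisVector hd (wordCenter ρ β (u.append i)) (wordCenter ρ β (u.append i'))
  rw [wordCenter_append, wordCenter_append, add_sub_add_left_eq_sub,
    ← mul_sub, sub_sub_sub_cancel_right, abs_mul, abs_of_pos (pow_pos hρ k), ← wordCenter_append,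
    ← wordCenter_append] at h1
  have h2 := mul_le_mul_of_nonneg_left
    (le_abs_offset_sub (by linarith : 0 ≤ β) h) (pow_pos hρ k).le
  rw [mem_closedBall, pow_succ] at hx hy
  rw [dist_comm] at hx
  have h4 := dist_triangle (wordCenter ρ β (u.append i) • axisVector hd) x
    (wordCenter ρ β (u.append i') • axisVector hd)
  have h5 := dist_triangle x y (wordCenter ρ β (u.append i') • axisVector hd)
  nlinarith

section AxisMoran

variable {d : ℕ} (hd : 1 ≤ d) {ρ β : ℝ} (hρ : 0 < ρ) (hβ : 2 * ρ < β) {n : ℕ → ℕ}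
  (hn2 : ∀ k, 2 ≤ n k) (hn : ∀ k, ((n k : ℝ) - 1) * β ≤ 2 * (1 - ρ))

theorem axisMoran_isHomogeneous : (axisMoran hd hρ hβ hn2 hn).IsHomogeneous :=
  fun _ => ⟨ρ, fun _ => rfl⟩

theorem card_moranWord (n : ℕ → ℕ) (k : ℕ) :
    Fintype.card (MoranWord n k) = ∏ j ∈ Finset.range k, n j := by
  rw [Fintype.card_pi, Finset.prod_range]
  simp

theorem limitSet_axisMoran_subset {k : ℕ} (hk : 1 ≤ k) :
    (axisMoran hd hρ hβ hn2 hn).limitSet ⊆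
      ⋃ u : MoranWord n k, closedBall (wordCenter ρ β u • axisVector hd) (ρ ^ k) := by
  obtain ⟨k, rfl⟩ := Nat.exists_eq_add_of_le' hk
  exact iInter_subset _ k

/-- The initial word of length `k` of an infinite word. -/
def wordTake {n : ℕ → ℕ} (ω : (j : ℕ) → Fin (n j)) (k : ℕ) : MoranWord n k := fun j => ω j

theorem wordTake_succ {n : ℕ → ℕ} (ω : (j : ℕ) → Fin (n j)) (k : ℕ) :
    wordTake ω (k + 1) = (wordTake ω k).append (ω k) := by
  funext j
  unfold MoranWord.append
  refine Fin.lastCases ?_ (fun j => ?_) j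
  · rw [Fin.snoc_last (α := fun j : Fin (k + 1) => Fin (n j))]; rfl
  · rw [Fin.snoc_castSucc (α := fun j : Fin (k + 1) => Fin (n j))]; rfl

theorem exists_mem_basicSet_wordTake (S : MoranStructure d) (ω : (j : ℕ) → Fin (S.n j)) :
    ∃ x, ∀ k, x ∈ S.basicSet k (wordTake ω k) := by
  have hc : ∀ k u, IsCompact (S.basicSet k u) ∧ (S.basicSet k u).Nonempty := fun k u => by
    obtain ⟨Ψ, hΨ⟩ := S.exists_similarity k u
    rw [hΨ]
    exact ⟨S.isCompact_J.image (Dilation.toContinuous Ψ),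
      (S.interior_J_nonempty.mono interior_subset).image _⟩
  have := IsCompact.nonempty_iInter_of_sequence_nonempty_isCompact_isClosed
    (fun k => S.basicSet k (wordTake ω k))
    (fun k => by rw [wordTake_succ]; exact S.basicSet_append_subset k _ _)
    (fun k => (hc k _).2) (hc 0 _).1 (fun k => (hc k _).1.isClosed)
  obtain ⟨x, hx⟩ := this
  exact ⟨x, fun k => mem_iInter.1 hx k⟩

/-- The natural mass distribution on the limit set. -/
theorem exists_mass_distribution :
    ∃ μ : OuterMeasure (EuclideanSpace ℝ (Fin d)),
      1 ≤ μ (axisMoran hd hρ hβ hn2 hn).limitSet ∧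
      ∀ (k : ℕ) (U : Set (EuclideanSpace ℝ (Fin d))),
        (∀ x ∈ U, ∀ y ∈ U, dist x y < (β - 2 * ρ) * ρ ^ k) →
        μ U ≤ ∏ j ∈ Finset.range k, ((n j : ℕ) : ℝ≥0∞)⁻¹ := by
  have hρ1 : ρ ≤ 1 := by
    have h2 : (2 : ℝ) ≤ n 0 := by exact_mod_cast hn2 0
    nlinarith [hn 0]
  have hex : ∀ ω : (j : ℕ) → Fin (n j), ∃ x, ∀ k,
      x ∈ closedBall (wordCenter ρ β (wordTake ω k) • axisVector hd) (ρ ^ k) :=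
    exists_mem_basicSet_wordTake (axisMoran hd hρ hβ hn2 hn)
  choose x hx using hex
  have : ∀ j, NeZero (n j) := fun j => ⟨by have := hn2 j; omega⟩
  let ν : (j : ℕ) → Measure (Fin (n j)) := fun j => ProbabilityTheory.uniformOn univ
  have : ∀ j, IsProbabilityMeasure (ν j) := fun j =>
    ProbabilityTheory.isProbabilityMeasure_uniformOn finite_univ univ_nonempty
  -- Pushing forward as an outer measure avoids any measurability question about the coding map x.
  refine ⟨OuterMeasure.map x (Measure.infinitePi ν).toOuterMeasure, ?_, fun k U hU => ?_⟩
  · rw [OuterMeasure.map_apply]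
    have : x ⁻¹' (axisMoran hd hρ hβ hn2 hn).limitSet = univ := by
      refine eq_univ_of_forall fun ω => ?_
      exact mem_iInter.2 fun k => mem_iUnion.2 ⟨_, hx ω (k + 1)⟩
    rw [this]
    exact (measure_univ (μ := Measure.infinitePi ν)).ge
  · rw [OuterMeasure.map_apply]
    rcases (x ⁻¹' U).eq_empty_or_nonempty with h | ⟨ω₀, h₀⟩
    · rw [h]; simp
    -- Two codes that first differ at some j < k give points at least (β - 2ρ)ρ^j apart, too far for
    -- both to lie in U; so all codes of points of U share their first k letters.
    have hsub : x ⁻¹' U ⊆ Set.pi (Finset.range k) fun j => {ω₀ j} := by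
      intro ω hω j hj
      have hj : j < k := by simpa using hj
      induction j using Nat.strong_induction_on with
      | _ j ih =>
        by_contra hne
        have hpre : wordTake ω j = wordTake ω₀ j := by
          funext i
          exact ih i i.2 (by simpa using i.2.trans hj) (i.2.trans hj)
        have h1 := hx ω (j + 1)
        have h2 := hx ω₀ (j + 1)
        rw [wordTake_succ] at h1 h2
        rw [hpre] at h1
        have h3 := gap_le_dist hd hρ hβ _ hne h1 h2
        have h4 := hU _ hω _ h₀
        have h5 := pow_le_pow_of_le_one hρ.le hρ1 hj.le
        nlinarith
    refine (measure_mono hsub).trans ?_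
    change Measure.infinitePi ν _ ≤ _
    rw [Measure.infinitePi_pi _ (fun i _ => measurableSet_singleton _)]
    refine Finset.prod_le_prod' fun j _ => ?_
    simp only [ν, ProbabilityTheory.uniformOn_univ]
    simp

end AxisMoran

/-! ### The exponents of the branching numbers -/

/-- The exponent equals `m` on the blocks `[L ^ i, L ^ (i + 1))` with `i` even, and `1` on the
others. -/
def blockWeight (L m j : ℕ) : ℕ := if Even (Nat.log L j) then m else 1

/-- The partial sums of `blockWeight`. -/
def blockSum (L m k : ℕ) : ℕ := ∑ j ∈ Finset.range k, blockWeight L m j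

section BlockSum

variable {L m : ℕ}

theorem one_le_blockWeight (hm : 1 ≤ m) (j : ℕ) : 1 ≤ blockWeight L m j := by
  unfold blockWeight; split_ifs <;> omega

theorem blockWeight_le (hm : 1 ≤ m) (j : ℕ) : blockWeight L m j ≤ m := by
  unfold blockWeight; split_ifs <;> omega

theorem blockSum_sub {k l : ℕ} (h : k ≤ l) :
    blockSum L m l = blockSum L m k + ∑ j ∈ Finset.Ico k l, blockWeight L m j :=
  (Finset.sum_range_add_sum_Ico _ h).symm

theorem blockSum_add_sub_le (hm : 1 ≤ m) {k l : ℕ} (h : k ≤ l) :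
    (blockSum L m k : ℝ) + ((l : ℝ) - k) ≤ blockSum L m l := by
  rw [blockSum_sub h, ← Nat.cast_sub h]
  have := Finset.card_nsmul_le_sum (Finset.Ico k l) (blockWeight L m) 1
    (fun j _ => one_le_blockWeight hm j)
  rw [Nat.card_Ico, smul_eq_mul, mul_one] at this
  have : ((l - k : ℕ) : ℝ) ≤ ((∑ j ∈ Finset.Ico k l, blockWeight L m j : ℕ) : ℝ) := by
    exact_mod_cast this
  push_cast at this ⊢
  linarith

theorem blockSum_le_add_mul (hm : 1 ≤ m) {k l : ℕ} (h : k ≤ l) :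
    (blockSum L m l : ℝ) ≤ blockSum L m k + m * ((l : ℝ) - k) := by
  rw [blockSum_sub h, ← Nat.cast_sub h]
  have := Finset.sum_le_card_nsmul (Finset.Ico k l) (blockWeight L m) m
    (fun j _ => blockWeight_le hm j)
  rw [Nat.card_Ico, smul_eq_mul] at this
  have : ((∑ j ∈ Finset.Ico k l, blockWeight L m j : ℕ) : ℝ) ≤ (((l - k) * m : ℕ) : ℝ) := by
    exact_mod_cast this
  push_cast at this ⊢
  linarith

theorem blockSum_pow_succ (hL : 2 ≤ L) (i : ℕ) :
    blockSum L m (L ^ (i + 1)) =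
      blockSum L m (L ^ i) + (L ^ (i + 1) - L ^ i) * (if Even i then m else 1) := by
  rw [blockSum_sub (Nat.pow_le_pow_right (by omega) i.le_succ), Finset.sum_congr rfl
    (g := fun _ => if Even i then m else 1), Finset.sum_const, Nat.card_Ico, smul_eq_mul]
  intro j hj
  rw [Finset.mem_Ico] at hj
  rw [blockWeight, Nat.log_eq_of_pow_le_of_lt_pow hj.1 hj.2]

theorem blockSum_even_succ (hL : 2 ≤ L) (j : ℕ) :
    (blockSum L m (L ^ (2 * j + 1)) : ℝ) =
      blockSum L m (L ^ (2 * j)) + ((L : ℝ) ^ (2 * j) * L - L ^ (2 * j)) * m := by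
  have h : L ^ (2 * j) ≤ L ^ (2 * j + 1) := Nat.pow_le_pow_right (by omega) (Nat.le_succ _)
  rw [blockSum_pow_succ hL, if_pos (even_two_mul j)]
  push_cast [Nat.cast_sub h]
  ring

theorem blockSum_odd_succ (hL : 2 ≤ L) (j : ℕ) :
    (blockSum L m (L ^ (2 * (j + 1))) : ℝ) =
      blockSum L m (L ^ (2 * j + 1)) + ((L : ℝ) ^ (2 * j) * L * L - L ^ (2 * j) * L) := by
  have h : L ^ (2 * j + 1) ≤ L ^ (2 * j + 1 + 1) := Nat.pow_le_pow_right (by omega) (Nat.le_succ _)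
  rw [show 2 * (j + 1) = 2 * j + 1 + 1 by ring, blockSum_pow_succ hL, if_neg (by simp)]
  push_cast [Nat.cast_sub h]
  ring

/-- The recursion over two blocks is geometric and solves exactly. The constant L(m-1) is the only
deviation from proportionality, and it comes from the weight m at index 0. -/
theorem blockSum_even (hL : 2 ≤ L) (j : ℕ) :
    ((L : ℝ) + 1) * blockSum L m (L ^ (2 * j)) = (m + L) * (L : ℝ) ^ (2 * j) + L * (m - 1) := by
  induction j with
  | zero =>
    have : blockSum L m 1 = m := by simp [blockSum, blockWeight]
    simp only [mul_zero, pow_zero, this]; ring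
  | succ j ih =>
    rw [blockSum_odd_succ hL, blockSum_even_succ hL, show 2 * (j + 1) = 2 * j + 1 + 1 by ring,
      pow_succ, pow_succ]
    linear_combination ih

theorem blockSum_odd (hL : 2 ≤ L) (j : ℕ) :
    ((L : ℝ) + 1) * blockSum L m (L ^ (2 * j + 1)) =
      (L * m + 1) * (L : ℝ) ^ (2 * j + 1) + L * (m - 1) := by
  rw [blockSum_even_succ hL, pow_succ]
  linear_combination blockSum_even (m := m) hL j

/-- The exponent `f θ` in the normalisation of `blockSum`. -/
def blockExponent (L m : ℕ) (θ : ℝ) : ℝ := (L * m * θ + 1) / (L * θ + 1)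

theorem exists_pow_le_lt (hL : 2 ≤ L) {k : ℕ} (hk : 1 ≤ k) :
    ∃ j, L ^ (2 * j) ≤ k ∧ k < L ^ (2 * (j + 1)) := by
  refine ⟨Nat.log (L ^ 2) k, ?_, ?_⟩
  · rw [pow_mul]; exact Nat.pow_log_le_self _ (by omega)
  · rw [pow_mul]; exact Nat.lt_pow_succ_log_self (by nlinarith) _

variable {θ : ℝ}

theorem mul_blockExponent (hθ : 0 ≤ θ) :
    (L * θ + 1) * blockExponent L m θ = L * m * θ + 1 := by
  unfold blockExponent
  have : (0 : ℝ) < L * θ + 1 := by positivity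
  field_simp

/-- With p = L^(2j+1), increments of at most m bound the sum below before p, and increments of at
least 1 bound it below after p. The resulting bounds on the ratio rise and then fall, and x is
chosen so that they equal the exponent at k = x and at k = x/θ. Starting e too early costs at most m
e. -/
theorem le_blockSum_of_mem (hL : 2 ≤ L) (hm : 1 ≤ m) (hθ0 : 0 < θ) {j k : ℕ} {x e : ℝ}
    (he : 0 ≤ e) (hx : (L + 1) * x = (L : ℝ) ^ (2 * j + 1) * (1 + L * θ))
    (h1 : x - e ≤ k) (h2 : k * θ ≤ x) :
    blockExponent L m θ * k - m * e ≤ blockSum L m k := by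
  have hL' : (2 : ℝ) ≤ L := by exact_mod_cast hL
  have hm' : (1 : ℝ) ≤ m := by exact_mod_cast hm
  have hφ := mul_blockExponent (L := L) (m := m) hθ0.le
  have hp := blockSum_odd (m := m) hL j
  set φ := blockExponent L m θ
  have hD : (0 : ℝ) < L * θ + 1 := by positivity
  have hD' : (0 : ℝ) < (L : ℝ) + 1 := by positivity
  set p : ℝ := (L : ℝ) ^ (2 * j + 1) with hpdef
  have hpc : ((L ^ (2 * j + 1) : ℕ) : ℝ) = p := by push_cast; rfl
  refine le_of_mul_le_mul_left ?_ (mul_pos hD hD')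
  have hLm : 0 ≤ (L : ℝ) * (m - 1) := mul_nonneg (by linarith) (by linarith)
  rcases le_total k (L ^ (2 * j + 1)) with hk | hk
  · have h3 := blockSum_le_add_mul (L := L) hm hk
    rw [hpc] at h3
    set G : ℝ := (blockSum L m k : ℝ)
    set P : ℝ := (blockSum L m (L ^ (2 * j + 1)) : ℝ)
    have h4 : ((L : ℝ) + 1) * G ≥ (L + 1) * m * k - (m - 1) * p := by
      nlinarith [mul_le_mul_of_nonneg_left h3 hD'.le]
    have h5 : (L * θ + 1) * ((L : ℝ) + 1) * G ≥
        (L * θ + 1) * ((L + 1) * m * k - (m - 1) * p) := by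
      rw [mul_assoc]; exact mul_le_mul_of_nonneg_left h4 hD.le
    have h6 : (m - 1 : ℝ) * ((L + 1) * (x - e)) ≤ (m - 1) * ((L + 1) * k) :=
      mul_le_mul_of_nonneg_left (mul_le_mul_of_nonneg_left h1 hD'.le) (by linarith)
    have h7 : (L * θ + 1) * ((L : ℝ) + 1) * (φ * k) = (L * m * θ + 1) * (L + 1) * k := by
      linear_combination ((L : ℝ) + 1) * k * hφ
    have h8 : (m - 1 : ℝ) * ((L + 1) * x) = (m - 1) * (p * (1 + L * θ)) := by rw [hx]
    have h9 : (m - 1 : ℝ) * ((L + 1) * e) ≤ (L * θ + 1) * (L + 1) * (m * e) := by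
      have : (0 : ℝ) ≤ (L + 1) * e := by positivity
      have h10 : (0 : ℝ) ≤ L * θ * (m * ((L + 1) * e)) := by positivity
      nlinarith
    nlinarith
  · have h3 := blockSum_add_sub_le (L := L) hm hk
    rw [hpc] at h3
    set G : ℝ := (blockSum L m k : ℝ)
    set P : ℝ := (blockSum L m (L ^ (2 * j + 1)) : ℝ)
    have h4 : ((L : ℝ) + 1) * G ≥ (L + 1) * k + L * (m - 1) * p := by
      nlinarith [mul_le_mul_of_nonneg_left h3 hD'.le]
    have h5 : (L * θ + 1) * ((L : ℝ) + 1) * G ≥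
        (L * θ + 1) * ((L + 1) * k + L * (m - 1) * p) := by
      rw [mul_assoc]; exact mul_le_mul_of_nonneg_left h4 hD.le
    have h6 : (L * (m - 1) : ℝ) * ((L + 1) * (k * θ)) ≤ (L * (m - 1)) * ((L + 1) * x) :=
      mul_le_mul_of_nonneg_left (mul_le_mul_of_nonneg_left h2 hD'.le) hLm
    have h7 : (L * θ + 1) * ((L : ℝ) + 1) * (φ * k) = (L * m * θ + 1) * (L + 1) * k := by
      linear_combination ((L : ℝ) + 1) * k * hφ
    have h8 : (L * (m - 1) : ℝ) * ((L + 1) * x) = (L * (m - 1)) * (p * (1 + L * θ)) := by rw [hx]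
    have h9 : (0 : ℝ) ≤ (L * θ + 1) * (L + 1) * (m * e) := by positivity
    nlinarith

theorem blockExponent_inv_sq (hL : 2 ≤ L) :
    blockExponent L m (1 / (L : ℝ) ^ 2) = (m + L) / (L + 1) := by
  unfold blockExponent
  have : (0 : ℝ) < L := by exact_mod_cast (by omega : 0 < L)
  field_simp
  ring

/-- `blockSum` grows at least with its lower exponent. -/
theorem le_blockSum (hL : 2 ≤ L) (hm : 1 ≤ m) (k : ℕ) :
    blockExponent L m (1 / (L : ℝ) ^ 2) * k ≤ blockSum L m k := by
  rcases Nat.eq_zero_or_pos k with rfl | hk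
  · simp
  obtain ⟨j, h1, h2⟩ := exists_pow_le_lt hL hk
  have hL0 : (0 : ℝ) < L := by exact_mod_cast (by omega : 0 < L)
  have h1' : (L : ℝ) ^ (2 * j) ≤ k := by exact_mod_cast h1
  have h2' : (k : ℝ) ≤ (L : ℝ) ^ (2 * (j + 1)) := by exact_mod_cast h2.le
  -- For this θ the critical window is [L^(2j), L^(2j+2)], and such windows exhaust all k ≥ 1.
  have := le_blockSum_of_mem (θ := 1 / (L : ℝ) ^ 2) hL hm (by positivity) (j := j) (k := k)
    (x := (L : ℝ) ^ (2 * j)) (e := 0) le_rfl (by field_simp; ring) (by simpa using h1')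
    (by
      rw [mul_one_div, div_le_iff₀ (by positivity), ← pow_add]
      exact h2'.trans_eq (by ring))
  simpa using this

/-- At the ends of the sparse blocks the lower exponent is attained. -/
theorem blockSum_even_le (hL : 2 ≤ L) (hm : 1 ≤ m) (j : ℕ) :
    (blockSum L m (L ^ (2 * j)) : ℝ) ≤
      blockExponent L m (1 / (L : ℝ) ^ 2) * ((L ^ (2 * j) : ℕ) : ℝ) + m := by
  rw [blockExponent_inv_sq hL]
  have h := blockSum_even (m := m) hL j
  have hD : (0 : ℝ) < (L : ℝ) + 1 := by positivity
  have hm' : (1 : ℝ) ≤ m := by exact_mod_cast hm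
  refine le_of_mul_le_mul_left ?_ hD
  rw [h]
  push_cast
  field_simp
  nlinarith

theorem blockExponent_mono (hm : 1 ≤ m) {θ' : ℝ} (hθ : 0 ≤ θ) (h : θ ≤ θ') :
    blockExponent L m θ ≤ blockExponent L m θ' := by
  unfold blockExponent
  have hm' : (1 : ℝ) ≤ m := by exact_mod_cast hm
  have : 0 ≤ θ' := hθ.trans h
  rw [div_le_div_iff₀ (by positivity) (by positivity)]
  have : 0 ≤ (L : ℝ) * (m - 1) * (θ' - θ) :=
    mul_nonneg (mul_nonneg (by positivity) (by linarith)) (by linarith)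
  nlinarith

/-- The ratio between consecutive even powers of L is L², so a window this long cannot miss them
all. -/
theorem exists_even_pow (hL : 2 ≤ L) {k : ℕ} (hk : 1 ≤ k) (hθ : θ ≤ 1 / (L : ℝ) ^ 2) :
    ∃ j, k ≤ L ^ (2 * j) ∧ ((L ^ (2 * j) : ℕ) : ℝ) * θ ≤ k := by
  obtain ⟨j, h1, h2⟩ := exists_pow_le_lt hL hk
  refine ⟨j + 1, h2.le, ?_⟩
  have hL0 : (0 : ℝ) < L := by exact_mod_cast (by omega : 0 < L)
  have h1' : (L : ℝ) ^ (2 * j) ≤ k := by exact_mod_cast h1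
  push_cast
  calc (L : ℝ) ^ (2 * (j + 1)) * θ ≤ (L : ℝ) ^ (2 * (j + 1)) * (1 / (L : ℝ) ^ 2) := by gcongr
    _ = (L : ℝ) ^ (2 * j) := by field_simp; ring
    _ ≤ k := h1'

/-- Every window `[k, k / θ]` contains a level where `blockSum` is at most as given by the
exponent. -/
theorem exists_blockSum_le (hL : 2 ≤ L) (hm : 1 ≤ m) (hθ : 1 / (L : ℝ) ^ 2 ≤ θ) (hθ1 : θ ≤ 1)
    {k : ℕ} (hk : 1 ≤ k) :
    ∃ y : ℕ, k ≤ y ∧ y * θ ≤ k ∧ (blockSum L m y : ℝ) ≤ blockExponent L m θ * y + (2 * m : ℕ) := by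
  have hL' : (2 : ℝ) ≤ L := by exact_mod_cast hL
  have hm' : (1 : ℝ) ≤ m := by exact_mod_cast hm
  have hθ0 : 0 < θ := lt_of_lt_of_le (by positivity) hθ
  obtain ⟨j, h1, h2⟩ := exists_pow_le_lt hL hk
  have hφ := mul_blockExponent (L := L) (m := m) hθ0.le
  have hp := blockSum_odd (m := m) hL j
  have hφmono := blockExponent_mono (L := L) hm (by positivity) hθ
  have hG1 : (blockSum L m (L ^ (2 * (j + 1))) : ℝ) ≤ _ := blockSum_even_le hL hm (j + 1)
  set φ := blockExponent L m θ
  have hD : (0 : ℝ) < L * θ + 1 := by positivity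
  have hD' : (0 : ℝ) < (L : ℝ) + 1 := by positivity
  set p : ℝ := (L : ℝ) ^ (2 * j + 1) with hpdef
  have hpc : ((L ^ (2 * j + 1) : ℕ) : ℝ) = p := by push_cast; rfl
  have hp0 : 0 ≤ p := by positivity
  -- Left of the critical point the ratio at k itself is small enough. Otherwise the next even power
  -- of L is used if it fits in the window, and failing that the right end ⌊k/θ⌋. Of the error 2m,
  -- one m pays for the constant L(m-1)/(L+1) and the other for this rounding.
  by_cases hcase : (L + 1) * (k : ℝ) ≤ p * (1 + L * θ)
  · refine ⟨k, le_rfl, mul_le_of_le_one_right (by positivity) hθ1, ?_⟩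
    have h3 : (blockSum L m k : ℝ) ≤ blockSum L m (L ^ (2 * j + 1)) + m * (k - p) := by
      have := blockSum_le_add_mul (L := L) hm h1
      rw [blockSum_even_succ hL, hpdef, pow_succ]
      push_cast at this ⊢
      linarith
    refine le_of_mul_le_mul_left ?_ (mul_pos hD hD')
    set G : ℝ := (blockSum L m k : ℝ)
    have h4 : ((L : ℝ) + 1) * G ≤ (L + 1) * m * k - (m - 1) * p + L * (m - 1) := by
      nlinarith [mul_le_mul_of_nonneg_left h3 hD'.le]
    have h5 := mul_le_mul_of_nonneg_left h4 hD.le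
    have h6 := mul_le_mul_of_nonneg_left hcase (sub_nonneg.2 hm')
    have h7 : (L * θ + 1) * ((L : ℝ) + 1) * (φ * k) = (L * m * θ + 1) * (L + 1) * k := by
      linear_combination ((L : ℝ) + 1) * k * hφ
    have h8 : (L * θ + 1) * ((L : ℝ) * (m - 1)) ≤ (L * θ + 1) * ((L + 1) * (2 * m)) :=
      mul_le_mul_of_nonneg_left (by nlinarith) hD.le
    push_cast
    linarith
  · push Not at hcase
    by_cases hq : ((L ^ (2 * (j + 1)) : ℕ) : ℝ) * θ ≤ k
    · refine ⟨_, h2.le, hq, hG1.trans ?_⟩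
      push_cast
      have : (0 : ℝ) ≤ (L : ℝ) ^ (2 * (j + 1)) := by positivity
      nlinarith
    push Not at hq
    have hkθ : (0 : ℝ) ≤ k / θ := by positivity
    have hy1 : ((⌊(k : ℝ) / θ⌋₊ : ℕ) : ℝ) * θ ≤ k :=
      (le_div_iff₀ hθ0).1 (Nat.floor_le hkθ)
    have hy2 : (k : ℝ) ≤ (⌊(k : ℝ) / θ⌋₊ + 1) * θ :=
      ((div_lt_iff₀ hθ0).1 (Nat.lt_floor_add_one _)).le
    refine ⟨⌊(k : ℝ) / θ⌋₊, Nat.le_floor ?_, hy1, ?_⟩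
    · rw [le_div_iff₀ hθ0]
      exact mul_le_of_le_one_right (by positivity) hθ1
    set y := ⌊(k : ℝ) / θ⌋₊
    have hyq : y ≤ L ^ (2 * (j + 1)) := by
      have : (y : ℝ) < ((L ^ (2 * (j + 1)) : ℕ) : ℝ) :=
        lt_of_mul_lt_mul_right (hy1.trans_lt hq) hθ0.le
      exact_mod_cast this.le
    have h3 : (blockSum L m y : ℝ) ≤ blockSum L m (L ^ (2 * j + 1)) + (y - p) := by
      have := blockSum_add_sub_le (L := L) hm hyq
      rw [blockSum_odd_succ hL] at this
      have hpp : p = (L : ℝ) ^ (2 * j) * L := pow_succ _ _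
      rw [hpp]
      push_cast at this ⊢
      have h : (L : ℝ) ^ (2 * (j + 1)) = L ^ (2 * j) * L * L := by ring
      linarith
    refine le_of_mul_le_mul_left ?_ (mul_pos hD hD')
    set G : ℝ := (blockSum L m y : ℝ)
    have h4 : ((L : ℝ) + 1) * G ≤ (L + 1) * y + L * (m - 1) * p + L * (m - 1) := by
      nlinarith [mul_le_mul_of_nonneg_left h3 hD'.le]
    have h5 := mul_le_mul_of_nonneg_left h4 hD.le
    have hLm : 0 ≤ (L : ℝ) * (m - 1) := mul_nonneg (by linarith) (by linarith)
    have h6 : L * (m - 1) * (p * (1 + L * θ)) ≤ L * (m - 1) * ((L + 1) * ((y + 1) * θ)) :=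
      mul_le_mul_of_nonneg_left
        (hcase.le.trans (mul_le_mul_of_nonneg_left hy2 hD'.le)) hLm
    have h7 : (L * θ + 1) * ((L : ℝ) + 1) * (φ * y) = (L * m * θ + 1) * (L + 1) * y := by
      linear_combination ((L : ℝ) + 1) * y * hφ
    have h8 : (L * θ + 1) * ((L : ℝ) * (m - 1)) ≤ (L * θ + 1) * ((L + 1) * m) :=
      mul_le_mul_of_nonneg_left (by nlinarith) hD.le
    have h9 : L * (m - 1) * ((L + 1) * θ) ≤ (L * θ + 1) * ((L + 1) * m) := by
      have : 0 ≤ (L : ℝ) * θ * (L + 1) := by positivity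
      have : 0 ≤ ((L : ℝ) + 1) * m := by positivity
      linarith
    push_cast
    linarith

end BlockSum

/-! ### General facts on intermediate dimensions -/

theorem sInf_coe_image_le {S : Set ℝ≥0} {t : ℝ≥0∞} (h : ∀ s : ℝ≥0, t < s → s ∈ S) :
    sInf ((fun s : ℝ≥0 => (s : ℝ≥0∞)) '' S) ≤ t := by
  refine le_of_forall_gt_imp_ge_of_dense fun a ha => ?_
  obtain ⟨s, hs, hsa⟩ := ENNReal.lt_iff_exists_nnreal_btwn.1 ha
  exact (sInf_le (mem_image_of_mem _ (h s hs))).trans hsa.le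

/-- Dropping the lower restriction on diameters leaves covers of vanishing mesh and vanishing s-sum,
so the s-dimensional Hausdorff measure is zero. -/
theorem dimH_le_lowerIntermediateDim {X : Type*} [EMetricSpace X] (θ : ℝ) (E : Set X) :
    dimH E ≤ lowerIntermediateDim θ E := by
  borelize X
  refine le_sInf ?_
  rintro _ ⟨s, hs, rfl⟩
  refine dimH_le_of_hausdorffMeasure_ne_top ?_
  have hpos : ∀ n : ℕ, (0 : ℝ) < 1 / ((n : ℝ) + 1) := fun n => by positivity
  choose δ hδ0 hδ 𝒰 hc hE hU hsum using
    fun n : ℕ => hs (1 / ((n : ℝ) + 1)) (hpos n) (1 / ((n : ℝ) + 1)) (hpos n)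
  have : ∀ n, Countable (𝒰 n) := fun n => (hc n).to_subtype
  have hlim : Tendsto (fun n : ℕ => ENNReal.ofReal (1 / ((n : ℝ) + 1))) atTop (𝓝 0) := by
    have := ENNReal.tendsto_ofReal (tendsto_one_div_add_atTop_nhds_zero_nat (𝕜 := ℝ))
    rwa [ENNReal.ofReal_zero] at this
  have h := Measure.hausdorffMeasure_le_liminf_tsum (s : ℝ) E
    (fun n : ℕ => ENNReal.ofReal (1 / ((n : ℝ) + 1))) hlim (fun n (U : 𝒰 n) => (U : Set X))
    (Eventually.of_forall fun n U =>
      (hU n U U.2).2.trans (ENNReal.ofReal_le_ofReal (hδ n)))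
    (Eventually.of_forall fun n => by rw [← sUnion_eq_iUnion]; exact hE n)
  have h0 : liminf (fun n => ∑' U : 𝒰 n, ediam (U : Set X) ^ (s : ℝ)) atTop ≤ 0 := by
    rw [← hlim.liminf_eq]
    exact liminf_le_liminf (Eventually.of_forall hsum)
  exact ((h.trans h0).trans_lt ENNReal.zero_lt_top).ne

theorem lowerIntermediateDim_le_upperIntermediateDim {X : Type*} [PseudoEMetricSpace X]
    (θ : ℝ) (E : Set X) : lowerIntermediateDim θ E ≤ upperIntermediateDim θ E := by
  refine sInf_le_sInf (image_mono fun s hs ε hε Δ hΔ => ?_)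
  obtain ⟨Δ', hΔ', h⟩ := hs ε hε
  exact ⟨min Δ Δ', lt_min hΔ hΔ', min_le_left _ _, h _ (lt_min hΔ hΔ') (min_le_right _ _)⟩

theorem ediam_closedBall_eq {X : Type*} [NormedAddCommGroup X] [NormedSpace ℝ X] [Nontrivial X]
    (x : X) {r : ℝ} (hr : 0 ≤ r) : ediam (closedBall x r) = ENNReal.ofReal (2 * r) := by
  rw [← diam_closedBall_eq x hr, diam, ENNReal.ofReal_toReal isBounded_closedBall.ediam_ne_top]

/-- A finite cover by small balls gives an admissible cover after enlarging the balls. -/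
theorem hasIntermediateCover_of_closedBall {X : Type*} [NormedAddCommGroup X] [NormedSpace ℝ X]
    [Nontrivial X] {E : Set X} {θ ε δ r D : ℝ} {s : ℝ≥0} {N : ℕ} (c : Fin N → X)
    (hE : E ⊆ ⋃ i, closedBall (c i) r) (hD0 : 0 ≤ D) (hr : 2 * r ≤ D)
    (h1 : lowerScale θ δ ≤ D) (h2 : D ≤ δ) (hsum : N * D ^ (s : ℝ) ≤ ε) :
    HasIntermediateCover E θ s ε δ := by
  have hd : ∀ i, ediam (closedBall (c i) (D / 2)) = ENNReal.ofReal D := fun i => by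
    rw [ediam_closedBall_eq _ (by linarith), mul_div_cancel₀ _ two_ne_zero]
  refine ⟨range fun i => closedBall (c i) (D / 2), countable_range _, ?_, ?_, ?_⟩
  · rw [sUnion_range]
    exact hE.trans (iUnion_mono fun i => closedBall_subset_closedBall (by linarith))
  · rintro _ ⟨i, rfl⟩
    rw [hd]
    exact ⟨ENNReal.ofReal_le_ofReal h1, ENNReal.ofReal_le_ofReal h2⟩
  -- The cover is a set, so coinciding balls count once; summing over indices can only overcount.
  · refine (ENNReal.tsum_le_tsum_comp_of_surjective
      (rangeFactorization_surjective (f := fun i => closedBall (c i) (D / 2))) _).trans ?_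
    simp only [rangeFactorization_coe, hd]
    rw [tsum_fintype, Finset.sum_const, Finset.card_univ, Fintype.card_fin, nsmul_eq_mul,
      ENNReal.ofReal_rpow_of_nonneg hD0 s.coe_nonneg, ← ENNReal.ofReal_natCast,
      ← ENNReal.ofReal_mul (by positivity)]
    exact ENNReal.ofReal_le_ofReal hsum

theorem one_le_mul_tsum_of_mass {X ι : Type*} [PseudoEMetricSpace X] [Countable ι]
    {μ : OuterMeasure X} {E : Set X} (hμ : 1 ≤ μ E) {K : ℝ≥0∞} {t : ℝ} (U : ι → Set X)
    (hU : E ⊆ ⋃ i, U i) (h : ∀ i, μ (U i) ≤ K * ediam (U i) ^ t) :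
    1 ≤ K * ∑' i, ediam (U i) ^ t := by
  rw [← ENNReal.tsum_mul_left]
  exact hμ.trans ((measure_mono hU).trans ((measure_iUnion_le _).trans (ENNReal.tsum_le_tsum h)))

/-- Mass distribution principle for the Hausdorff dimension. -/
theorem le_dimH_of_mass {X : Type*} [EMetricSpace X] {μ : OuterMeasure X} {E : Set X}
    (hμ : 1 ≤ μ E) {K r : ℝ≥0∞} (hK : K ≠ ∞) (hr : 0 < r) {t : ℝ≥0}
    (h : ∀ U : Set X, ediam U ≤ r → μ U ≤ K * ediam U ^ (t : ℝ)) : (t : ℝ≥0∞) ≤ dimH E := by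
  borelize X
  refine le_dimH_of_hausdorffMeasure_ne_zero fun h0 => ?_
  rw [Measure.hausdorffMeasure_apply] at h0
  have h1 := ENNReal.iSup_eq_zero.1 (ENNReal.iSup_eq_zero.1 h0 r) hr
  have h2 : (⨅ (U : ℕ → Set X) (_ : E ⊆ ⋃ n, U n) (_ : ∀ n, ediam (U n) ≤ r),
      ∑' n, ⨆ _ : (U n).Nonempty, ediam (U n) ^ (t : ℝ)) < (K + 1)⁻¹ := by
    rw [h1, ENNReal.inv_pos]
    exact ENNReal.add_ne_top.2 ⟨hK, ENNReal.one_ne_top⟩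
  simp only [iInf_lt_iff] at h2
  obtain ⟨U, hE, hU, hsum⟩ := h2
  have h3 : 1 ≤ K * ∑' n, ⨆ _ : (U n).Nonempty, ediam (U n) ^ (t : ℝ) := by
    rw [← ENNReal.tsum_mul_left]
    refine hμ.trans ((measure_mono hE).trans ((measure_iUnion_le _).trans
      (ENNReal.tsum_le_tsum fun n => ?_)))
    rcases (U n).eq_empty_or_nonempty with he | hne
    · rw [he]; simp
    · simpa [hne] using h _ (hU n)
  have h4 : K * (∑' n, ⨆ _ : (U n).Nonempty, ediam (U n) ^ (t : ℝ)) ≤ K * (K + 1)⁻¹ := by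
    gcongr
  have h5 : K * (K + 1)⁻¹ < 1 := by
    rw [← div_eq_mul_inv]
    refine ENNReal.div_lt_of_lt_mul' ?_
    rw [mul_one]
    exact ENNReal.lt_add_right hK one_ne_zero
  exact absurd (h3.trans h4) (not_le.2 h5)

/-- Mass distribution principle for the upper intermediate dimensions. -/
theorem le_upperIntermediateDim_of_mass {X : Type*} [PseudoEMetricSpace X] {μ : OuterMeasure X}
    {E : Set X} (hμ : 1 ≤ μ E) {K : ℝ≥0} {t : ℝ≥0} {θ : ℝ}
    (h : ∀ Δ : ℝ, 0 < Δ → ∃ δ, 0 < δ ∧ δ ≤ Δ ∧ ∀ U : Set X,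
      ENNReal.ofReal (lowerScale θ δ) ≤ ediam U → ediam U ≤ ENNReal.ofReal δ →
      μ U ≤ K * ediam U ^ (t : ℝ)) :
    (t : ℝ≥0∞) ≤ upperIntermediateDim θ E := by
  refine le_sInf ?_
  rintro _ ⟨s, hs, rfl⟩
  by_contra! hst
  have hst' : (s : ℝ) ≤ t := by exact_mod_cast (ENNReal.coe_lt_coe.1 hst).le
  obtain ⟨Δ, hΔ, hcov⟩ := hs (1 / ((K : ℝ) + 1)) (by positivity)
  -- Diameters of at most 1 make the t-sum no larger than the s-sum, since s ≤ t.
  obtain ⟨δ, hδ0, hδ, hU⟩ := h (min Δ 1) (lt_min hΔ one_pos)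
  obtain ⟨𝒰, hc, hE, hd, hsum⟩ := hcov δ hδ0 (hδ.trans (min_le_left _ _))
  have := hc.to_subtype
  have h1 := one_le_mul_tsum_of_mass hμ (fun U : 𝒰 => (U : Set X))
    (by rwa [← sUnion_eq_iUnion]) (fun U => hU U (hd U U.2).1 (hd U U.2).2)
  have h2 : ∑' U : 𝒰, ediam (U : Set X) ^ (t : ℝ) ≤ ∑' U : 𝒰, ediam (U : Set X) ^ (s : ℝ) := by
    refine ENNReal.tsum_le_tsum fun U => ENNReal.rpow_le_rpow_of_exponent_ge ?_ hst'
    refine (hd U U.2).2.trans ?_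
    rw [← ENNReal.ofReal_one]
    exact ENNReal.ofReal_le_ofReal (hδ.trans (min_le_right _ _))
  have h3 : (K : ℝ≥0∞) * ∑' U : 𝒰, ediam (U : Set X) ^ (t : ℝ) ≤
      ENNReal.ofReal (K * (1 / ((K : ℝ) + 1))) := by
    rw [ENNReal.ofReal_mul K.coe_nonneg, ENNReal.ofReal_coe_nnreal]
    gcongr
    exact h2.trans hsum
  have h4 : ENNReal.ofReal (K * (1 / ((K : ℝ) + 1))) < 1 := by
    rw [← ENNReal.ofReal_one]
    refine (ENNReal.ofReal_lt_ofReal_iff one_pos).2 ?_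
    rw [mul_one_div, div_lt_one (by positivity)]
    linarith
  exact absurd (h1.trans h3) (not_le.2 h4)

theorem lowerScale_le {θ δ : ℝ} (hθ0 : 0 ≤ θ) (hθ1 : θ ≤ 1) (hδ0 : 0 < δ) (hδ1 : δ ≤ 1) :
    lowerScale θ δ ≤ δ := by
  unfold lowerScale
  split_ifs with h
  · exact hδ0.le
  · have : 0 < θ := lt_of_le_of_ne hθ0 (Ne.symm h)
    exact Real.rpow_le_self_of_le_one hδ0.le hδ1 ((one_le_div this).2 hθ1)

/-! ### Sets with a prescribed growth of the number of basic balls -/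

/-- `E` is covered by `2 ^ g k` balls of radius `ρ ^ k` and carries a mass distribution that gives
mass at most `2 ^ (- g k)` to sets of diameter comparable to `ρ ^ k`. -/
structure HasGrowth {X : Type*} [PseudoMetricSpace X] (E : Set X) (ρ : ℝ) (g : ℕ → ℕ) : Prop where
  exists_cover : ∀ k, 1 ≤ k → ∃ c : Fin (2 ^ g k) → X, E ⊆ ⋃ i, closedBall (c i) (ρ ^ k)
  exists_mass : ∃ γ : ℝ, 0 < γ ∧ ∃ μ : OuterMeasure X, 1 ≤ μ E ∧ ∀ (k : ℕ) (U : Set X),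
    (∀ x ∈ U, ∀ y ∈ U, dist x y < γ * ρ ^ k) → μ U ≤ ENNReal.ofReal ((2 ^ g k)⁻¹)

section HasGrowth

variable {T ρ φ : ℝ} {g : ℕ → ℕ}

theorem two_rpow_eq_rpow (hT : 0 < T) (hρ : ρ = 2 ^ (-T)) (k : ℕ) :
    (2 : ℝ) ^ (φ * k) = (ρ ^ k) ^ (-(φ / T)) := by
  rw [hρ, ← Real.rpow_natCast, ← Real.rpow_mul two_pos.le, ← Real.rpow_mul two_pos.le]
  congr 1
  field_simp

theorem rho_pos (hρ : ρ = 2 ^ (-T)) : 0 < ρ := by rw [hρ]; positivity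

theorem rho_lt_one (hT : 0 < T) (hρ : ρ = 2 ^ (-T)) : ρ < 1 := by
  rw [hρ]; exact Real.rpow_lt_one_of_one_lt_of_neg one_lt_two (by linarith)

/-- A cover at level k by sets of diameter comparable to ρ^k has s-cost decaying geometrically in k
as soon as s > φ/T. -/
theorem two_pow_mul_rpow_le (hT : 0 < T) (hρ : ρ = 2 ^ (-T)) {A C D s : ℝ} {k : ℕ}
    (hg : (g k : ℝ) ≤ φ * k + A) (hC : 0 ≤ C) (hD0 : 0 ≤ D) (hD : D ≤ C * ρ ^ k) (hs : 0 ≤ s) :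
    ((2 ^ g k : ℕ) : ℝ) * D ^ s ≤ 2 ^ A * C ^ s * (ρ ^ (s - φ / T)) ^ k := by
  have hρ0 := rho_pos hρ
  have h1 : ((2 ^ g k : ℕ) : ℝ) ≤ 2 ^ A * (ρ ^ k) ^ (-(φ / T)) := by
    rw [← two_rpow_eq_rpow hT hρ, ← Real.rpow_add two_pos]
    push_cast
    rw [← Real.rpow_natCast]
    exact Real.rpow_le_rpow_of_exponent_le one_le_two (by linarith)
  have h2 : D ^ s ≤ C ^ s * (ρ ^ k) ^ s := by
    rw [← Real.mul_rpow hC (by positivity)]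
    exact Real.rpow_le_rpow hD0 hD hs
  calc ((2 ^ g k : ℕ) : ℝ) * D ^ s
      ≤ (2 ^ A * (ρ ^ k) ^ (-(φ / T))) * (C ^ s * (ρ ^ k) ^ s) := by
        gcongr
    _ = 2 ^ A * C ^ s * ((ρ ^ k) ^ s * (ρ ^ k) ^ (-(φ / T))) := by ring
    _ = 2 ^ A * C ^ s * (ρ ^ (s - φ / T)) ^ k := by
        rw [← Real.rpow_add (by positivity), ← sub_eq_add_neg, ← Real.rpow_natCast,
          ← Real.rpow_natCast, ← Real.rpow_mul hρ0.le, ← Real.rpow_mul hρ0.le, mul_comm (k : ℝ)]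

theorem exists_forall_mul_pow_le (hT : 0 < T) (hρ : ρ = 2 ^ (-T)) {M u ε : ℝ}
    (hu : 0 < u) (hε : 0 < ε) : ∃ k₀ : ℕ, ∀ k, k₀ ≤ k → M * (ρ ^ u) ^ k ≤ ε := by
  have hρ0 := rho_pos hρ
  have h := (tendsto_pow_atTop_nhds_zero_of_lt_one (Real.rpow_nonneg hρ0.le u)
    (Real.rpow_lt_one hρ0.le (rho_lt_one hT hρ) hu)).const_mul M
  rw [mul_zero] at h
  exact eventually_atTop.1 (h.eventually_le_const hε)

theorem exists_forall_two_mul_pow_le (hT : 0 < T) (hρ : ρ = 2 ^ (-T)) {Δ : ℝ} (hΔ : 0 < Δ) :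
    ∃ k₀ : ℕ, ∀ k, k₀ ≤ k → 2 * ρ ^ k ≤ Δ := by
  simpa using exists_forall_mul_pow_le hT hρ (M := 2) one_pos hΔ

namespace HasGrowth

variable {X : Type*} {E : Set X}

/-! ### Upper bounds from covers at a single scale -/

section Upper

variable [NormedAddCommGroup X] [NormedSpace ℝ X] [Nontrivial X]

/-- Only some arbitrarily small δ is required, so infinitely many good levels q suffice: balls of
diameter exactly δ = 2ρ^q are admissible for every θ. -/
theorem lowerIntermediateDim_le (h : HasGrowth E ρ g) (hT : 0 < T) (hρ : ρ = 2 ^ (-T)) {θ A : ℝ}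
    (hθ0 : 0 ≤ θ) (hθ1 : θ ≤ 1) (hg : ∀ k : ℕ, ∃ q, k ≤ q ∧ (g q : ℝ) ≤ φ * q + A) :
    lowerIntermediateDim θ E ≤ ENNReal.ofReal (φ / T) := by
  have hρ0 := rho_pos hρ
  refine sInf_coe_image_le fun s hs ε hε Δ hΔ => ?_
  rw [← ENNReal.ofReal_coe_nnreal] at hs
  have hs' : φ / T < s := (ENNReal.ofReal_lt_ofReal_iff'.1 hs).1
  obtain ⟨k₁, hk₁⟩ := exists_forall_mul_pow_le hT hρ
    (M := 2 ^ A * 2 ^ (s : ℝ)) (sub_pos.2 hs') hε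
  obtain ⟨k₂, hk₂⟩ := exists_forall_two_mul_pow_le hT hρ (lt_min hΔ one_pos)
  obtain ⟨q, hq, hgq⟩ := hg (k₁ + k₂ + 1)
  obtain ⟨c, hc⟩ := h.exists_cover q (by omega)
  have hδ0 : 0 < 2 * ρ ^ q := by positivity
  have hδ := hk₂ q (by omega)
  refine ⟨2 * ρ ^ q, hδ0, hδ.trans (min_le_left _ _),
    hasIntermediateCover_of_closedBall c hc hδ0.le le_rfl
      (lowerScale_le hθ0 hθ1 hδ0 (hδ.trans (min_le_right _ _))) le_rfl ?_⟩
  exact (two_pow_mul_rpow_le hT hρ hgq two_pos.le hδ0.le le_rfl s.2).trans (hk₁ q (by omega))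

theorem lowerScale_le_mul_pow (hT : 0 < T) (hρ : ρ = 2 ^ (-T)) {θ δ : ℝ} (hθ0 : 0 ≤ θ)
    (hδ0 : 0 < δ) {n y : ℕ} (hδ : δ ≤ 2 * ρ ^ n) (hy : y * θ ≤ (n + 1 : ℕ)) :
    lowerScale θ δ ≤ (2 / ρ) ^ (1 / θ) * ρ ^ y := by
  have hρ0 := rho_pos hρ
  unfold lowerScale
  split_ifs with h
  · positivity
  have hθ : 0 < θ := lt_of_le_of_ne hθ0 (Ne.symm h)
  have h1 : 2 * ρ ^ n = 2 / ρ * ρ ^ (n + 1) := by rw [pow_succ]; field_simp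
  calc δ ^ (1 / θ) ≤ (2 / ρ * ρ ^ (n + 1)) ^ (1 / θ) := by
        rw [← h1]; exact Real.rpow_le_rpow hδ0.le hδ (by positivity)
    _ = (2 / ρ) ^ (1 / θ) * ρ ^ (((n + 1 : ℕ) : ℝ) * (1 / θ)) := by
        rw [Real.mul_rpow (by positivity) (by positivity), ← Real.rpow_natCast,
          ← Real.rpow_mul hρ0.le]
    _ ≤ (2 / ρ) ^ (1 / θ) * ρ ^ y := by
        rw [← Real.rpow_natCast ρ y]
        refine mul_le_mul_of_nonneg_left ?_ (by positivity)
        refine Real.rpow_le_rpow_of_exponent_ge hρ0 (rho_lt_one hT hρ).le ?_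
        rw [mul_one_div, le_div_iff₀ hθ]
        exact hy

theorem upperIntermediateDim_le (h : HasGrowth E ρ g) (hT : 0 < T) (hρ : ρ = 2 ^ (-T)) {θ A : ℝ}
    (hθ0 : 0 ≤ θ) (hθ1 : θ ≤ 1)
    (hg : ∀ k : ℕ, 1 ≤ k → ∃ y, k ≤ y ∧ y * θ ≤ k ∧ (g y : ℝ) ≤ φ * y + A) :
    upperIntermediateDim θ E ≤ ENNReal.ofReal (φ / T) := by
  have hρ0 := rho_pos hρ
  have hρ1 := rho_lt_one hT hρ
  refine sInf_coe_image_le fun s hs ε hε => ?_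
  rw [← ENNReal.ofReal_coe_nnreal] at hs
  have hs' : φ / T < s := (ENNReal.ofReal_lt_ofReal_iff'.1 hs).1
  -- The diameter used below is the larger of 2ρ^y and the smallest allowed one. As y lies in the
  -- window of n + 1, both are at most a constant times ρ^y, and C is the sum of the two constants.
  set C : ℝ := 2 + (2 / ρ) ^ (1 / θ) with hC
  have hC1 : 0 ≤ (2 / ρ) ^ (1 / θ) := by positivity
  have hC0 : 0 ≤ C := by positivity
  obtain ⟨k₁, hk₁⟩ := exists_forall_mul_pow_le hT hρ
    (M := 2 ^ A * C ^ (s : ℝ)) (sub_pos.2 hs') hε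
  refine ⟨min 1 (2 * ρ ^ k₁), by positivity, fun δ hδ0 hδ => ?_⟩
  have hδ1 : δ ≤ 1 := hδ.trans (min_le_left _ _)
  have hδ2 : δ ≤ 2 * ρ ^ k₁ := hδ.trans (min_le_right _ _)
  obtain ⟨n, hn1, hn2⟩ := exists_nat_pow_near_of_lt_one (by linarith : 0 < δ / 2)
    (by linarith : δ / 2 ≤ 1) hρ0 hρ1
  have hkn : k₁ < n + 1 :=
    (pow_lt_pow_iff_right_of_lt_one₀ hρ0 hρ1).1 (hn1.trans_le (by linarith))
  obtain ⟨y, hy1, hy2, hgy⟩ := hg (n + 1) (by omega)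
  obtain ⟨c, hc⟩ := h.exists_cover y (by omega)
  have hρy : 0 < ρ ^ y := by positivity
  have hyn : ρ ^ y ≤ ρ ^ (n + 1) := pow_le_pow_of_le_one hρ0.le hρ1.le hy1
  have hls := lowerScale_le_mul_pow hT hρ hθ0 hδ0 (by linarith : δ ≤ 2 * ρ ^ n) hy2
  have hD0 : 0 ≤ max (2 * ρ ^ y) (lowerScale θ δ) := le_max_of_le_left (by positivity)
  refine hasIntermediateCover_of_closedBall c hc hD0 (le_max_left _ _) (le_max_right _ _)
    (max_le (by linarith) (lowerScale_le hθ0 hθ1 hδ0 hδ1)) ?_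
  refine (two_pow_mul_rpow_le hT hρ hgy hC0 hD0 (max_le ?_ ?_) s.2).trans (hk₁ y (by omega))
  · rw [hC, add_mul]; linarith [mul_nonneg hC1 hρy.le]
  · rw [hC, add_mul]; linarith

end Upper

/-! ### Lower bounds from the mass distribution -/

section Lower

/-- A bound on the mass of a set in terms of its diameter, if `g` is large at the matching
level. -/
theorem exists_mass_le [PseudoMetricSpace X] (h : HasGrowth E ρ g) (hT : 0 < T)
    (hρ : ρ = 2 ^ (-T)) (hφ : 0 < φ) (hg : Tendsto g atTop atTop) :
    ∃ (e : ℕ) (μ : OuterMeasure X), 1 ≤ μ E ∧ ∀ A : ℝ, ∃ K : ℝ≥0, ∀ U : Set X,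
      ediam U ≤ ENNReal.ofReal (ρ ^ e) →
      (∀ k : ℕ, ENNReal.ofReal (ρ ^ (k + 1 + e)) < ediam U →
        ediam U ≤ ENNReal.ofReal (ρ ^ (k + e)) → φ * k - A ≤ g k) →
      μ U ≤ K * ediam U ^ (φ / T) := by
  have hρ0 := rho_pos hρ
  have hρ1 := rho_lt_one hT hρ
  obtain ⟨γ, hγ, μ, hμ, hmass⟩ := h.exists_mass
  obtain ⟨e, he⟩ := exists_pow_lt_of_lt_one hγ hρ1
  have hmass' : ∀ (k : ℕ) (U : Set X), ediam U ≤ ENNReal.ofReal (ρ ^ (k + e)) →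
      μ U ≤ ENNReal.ofReal ((2 ^ g k)⁻¹) := fun k U hU => by
    refine hmass k U fun x hx y hy => ?_
    have h1 : ENNReal.ofReal (dist x y) ≤ ENNReal.ofReal (ρ ^ (k + e)) := by
      rw [← edist_dist]; exact (edist_le_ediam_of_mem hx hy).trans hU
    rw [ENNReal.ofReal_le_ofReal_iff (by positivity), pow_add, mul_comm] at h1
    exact h1.trans_lt (mul_lt_mul_of_pos_right he (by positivity))
  refine ⟨e, μ, hμ, fun A => ⟨(2 ^ A * ρ ^ (-((1 + e) * (φ / T)))).toNNReal, fun U hU hk => ?_⟩⟩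
  have ht : 0 < φ / T := by positivity
  -- Sets of zero diameter are bounded at every level, so their mass vanishes because g tends to
  -- infinity.
  rcases eq_or_ne (ediam U) 0 with h0 | h0
  · rw [h0, ENNReal.zero_rpow_of_pos ht, mul_zero]
    have hlim : Tendsto (fun k => ENNReal.ofReal (((2 : ℝ) ^ g k)⁻¹)) atTop (𝓝 0) := by
      rw [← ENNReal.ofReal_zero]
      refine ENNReal.tendsto_ofReal (Tendsto.comp tendsto_inv_atTop_zero ?_)
      exact (tendsto_pow_atTop_atTop_of_one_lt one_lt_two).comp hg
    exact ge_of_tendsto' hlim fun k => hmass' k U (by rw [h0]; exact zero_le)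
  have htop : ediam U ≠ ∞ := (hU.trans_lt ENNReal.ofReal_lt_top).ne
  obtain ⟨D, hD, hDU⟩ : ∃ D : ℝ, 0 < D ∧ ediam U = ENNReal.ofReal D :=
    ⟨_, ENNReal.toReal_pos h0 htop, (ENNReal.ofReal_toReal htop).symm⟩
  rw [hDU] at hU hk ⊢
  rw [ENNReal.ofReal_le_ofReal_iff (by positivity)] at hU
  have hρe : 0 < ρ ^ e := by positivity
  obtain ⟨k, hk1, hk2⟩ := exists_nat_pow_near_of_lt_one (div_pos hD hρe)
    ((div_le_one hρe).2 hU) hρ0 hρ1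
  rw [lt_div_iff₀ hρe, ← pow_add] at hk1
  rw [div_le_iff₀ hρe, ← pow_add] at hk2
  have hgk := hk k ((ENNReal.ofReal_lt_ofReal_iff hD).2 hk1) (ENNReal.ofReal_le_ofReal hk2)
  refine (hmass' k U (by rw [hDU]; exact ENNReal.ofReal_le_ofReal hk2)).trans ?_
  change _ ≤ ENNReal.ofReal _ * _
  rw [ENNReal.ofReal_rpow_of_pos hD, ← ENNReal.ofReal_mul (by positivity)]
  refine ENNReal.ofReal_le_ofReal ?_
  have h1 : ((2 : ℝ) ^ g k)⁻¹ ≤ 2 ^ A * (ρ ^ k) ^ (φ / T) := by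
    have h2 := two_rpow_eq_rpow (φ := -φ) hT hρ k
    rw [neg_div, neg_neg] at h2
    rw [← h2, ← Real.rpow_add two_pos, ← Real.rpow_natCast, ← Real.rpow_neg two_pos.le]
    exact Real.rpow_le_rpow_of_exponent_le one_le_two (by linarith)
  have h3 : (ρ ^ k) ^ (φ / T) = ρ ^ (-((1 + e) * (φ / T))) * (ρ ^ (k + 1 + e)) ^ (φ / T) := by
    rw [← Real.rpow_natCast, ← Real.rpow_natCast, ← Real.rpow_mul hρ0.le,
      ← Real.rpow_mul hρ0.le, ← Real.rpow_add hρ0]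
    congr 1
    push_cast
    ring
  calc ((2 : ℝ) ^ g k)⁻¹ ≤ 2 ^ A * (ρ ^ k) ^ (φ / T) := h1
    _ = 2 ^ A * ρ ^ (-((1 + e) * (φ / T))) * (ρ ^ (k + 1 + e)) ^ (φ / T) := by rw [h3]; ring
    _ ≤ 2 ^ A * ρ ^ (-((1 + e) * (φ / T))) * D ^ (φ / T) := by gcongr

theorem le_dimH [MetricSpace X] (h : HasGrowth E ρ g) (hT : 0 < T) (hρ : ρ = 2 ^ (-T))
    (hφ : 0 < φ) (hg : Tendsto g atTop atTop) (hgk : ∀ k : ℕ, φ * k ≤ g k) :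
    ENNReal.ofReal (φ / T) ≤ dimH E := by
  have hρ0 := rho_pos hρ
  obtain ⟨e, μ, hμ, hA⟩ := h.exists_mass_le hT hρ hφ hg
  obtain ⟨K, hK⟩ := hA 0
  have ht : ((φ / T).toNNReal : ℝ) = φ / T := Real.coe_toNNReal _ (by positivity)
  refine le_dimH_of_mass hμ (K := K) ENNReal.coe_ne_top
    (ENNReal.ofReal_pos.2 (pow_pos hρ0 e)) fun U hU => ?_
  rw [ht]
  exact hK U hU fun k _ _ => by simpa using hgk k

theorem le_upperIntermediateDim [PseudoMetricSpace X] (h : HasGrowth E ρ g) (hT : 0 < T)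
    (hρ : ρ = 2 ^ (-T)) (hφ : 0 < φ) (hg : Tendsto g atTop atTop) {θ : ℝ} (hθ : 0 < θ)
    (hgk : ∀ e : ℝ, 0 ≤ e → ∃ A : ℝ, ∀ x₀ : ℝ, ∃ x, x₀ ≤ x ∧
      ∀ k : ℕ, x - e ≤ k → k * θ ≤ x → φ * k - A ≤ g k) :
    ENNReal.ofReal (φ / T) ≤ upperIntermediateDim θ E := by
  have hρ0 := rho_pos hρ
  have hρ1 := rho_lt_one hT hρ
  obtain ⟨e, μ, hμ, hA⟩ := h.exists_mass_le hT hρ hφ hg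
  -- Take δ = ρ^x. A set with diameter between δ^(1/θ) and δ is matched to a level k with x < k + 1
  -- + e and (k + e)θ ≤ x, hence the tolerance 1 + e.
  obtain ⟨A, hx⟩ := hgk (1 + e) (by positivity)
  obtain ⟨K, hK⟩ := hA A
  have ht : ((φ / T).toNNReal : ℝ) = φ / T := Real.coe_toNNReal _ (by positivity)
  refine le_upperIntermediateDim_of_mass hμ (K := K) fun Δ hΔ => ?_
  obtain ⟨n, hn⟩ := exists_pow_lt_of_lt_one hΔ hρ1
  obtain ⟨x, hx0, hxk⟩ := hx (n + e)
  refine ⟨ρ ^ x, by positivity, ?_, fun U hU1 hU2 => ?_⟩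
  · refine le_trans ?_ hn.le
    rw [← Real.rpow_natCast]
    exact Real.rpow_le_rpow_of_exponent_ge hρ0 hρ1.le (by linarith [Nat.cast_nonneg (α := ℝ) e])
  rw [ht]
  refine hK U (hU2.trans (ENNReal.ofReal_le_ofReal ?_)) fun k hk1 hk2 => hxk k ?_ ?_
  · rw [← Real.rpow_natCast]
    exact Real.rpow_le_rpow_of_exponent_ge hρ0 hρ1.le (by linarith [Nat.cast_nonneg (α := ℝ) n])
  · have h1 := hk1.trans_le hU2
    rw [ENNReal.ofReal_lt_ofReal_iff (by positivity), ← Real.rpow_natCast,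
      Real.rpow_lt_rpow_left_iff_of_base_lt_one hρ0 hρ1] at h1
    push_cast at h1
    linarith
  · have h1 := hU1.trans hk2
    rw [lowerScale, if_neg hθ.ne', ENNReal.ofReal_le_ofReal_iff (by positivity),
      ← Real.rpow_mul hρ0.le, ← Real.rpow_natCast,
      Real.rpow_le_rpow_left_iff_of_base_lt_one hρ0 hρ1, mul_one_div, le_div_iff₀ hθ] at h1
    push_cast at h1
    nlinarith [Nat.cast_nonneg (α := ℝ) e]

end Lower

end HasGrowth

end HasGrowth

/-! ### The Moran set with block exponents -/

section BlockMoran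

variable {L m : ℕ} {T ρ : ℝ}

/-- This spacing places 2^m equally spaced children from one end of the parent to the other. They
are disjoint exactly when ρ 2^m < 1, that is T > m, which is the condition c > a. Levels with fewer
children use only the first positions. -/
theorem two_mul_lt_spacing (hm : 1 ≤ m) (hT : m < T) (hρ : ρ = 2 ^ (-T)) :
    2 * ρ < 2 * (1 - ρ) / ((2 : ℝ) ^ m - 1) := by
  have h2 : (2 : ℝ) ≤ 2 ^ m := by simpa using pow_le_pow_right₀ (one_le_two (α := ℝ)) hm
  have h1 : ρ * 2 ^ m < 1 := by
    rw [hρ, ← Real.rpow_natCast, ← Real.rpow_add two_pos]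
    exact Real.rpow_lt_one_of_one_lt_of_neg one_lt_two (by linarith)
  rw [lt_div_iff₀ (by linarith)]
  linarith

theorem branching_mul_spacing_le (hm : 1 ≤ m) (hT : m < T) (hρ : ρ = 2 ^ (-T)) (k : ℕ) :
    (((2 ^ blockWeight L m k : ℕ) : ℝ) - 1) * (2 * (1 - ρ) / ((2 : ℝ) ^ m - 1)) ≤
      2 * (1 - ρ) := by
  have h2 : (2 : ℝ) ≤ 2 ^ m := by simpa using pow_le_pow_right₀ (one_le_two (α := ℝ)) hm
  have h3 : (2 : ℝ) ^ blockWeight L m k ≤ 2 ^ m :=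
    pow_le_pow_right₀ one_le_two (blockWeight_le hm k)
  have h4 := rho_lt_one ((Nat.cast_nonneg m).trans_lt hT) hρ
  rw [← mul_div_assoc, div_le_iff₀ (by linarith)]
  push_cast
  nlinarith

theorem two_le_branching (hm : 1 ≤ m) (k : ℕ) : 2 ≤ 2 ^ blockWeight L m k := by
  simpa using Nat.pow_le_pow_right two_pos (one_le_blockWeight (L := L) hm k)

/-- The homogeneous Moran structure with ratios `2 ^ (-T)` and branching numbers
`2 ^ blockWeight L m k`. -/
def blockMoran {d : ℕ} (hd : 1 ≤ d) (L : ℕ) (hm : 1 ≤ m) (hT : m < T) (hρ : ρ = 2 ^ (-T)) :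
    MoranStructure d :=
  axisMoran hd (rho_pos hρ) (two_mul_lt_spacing hm hT hρ) (two_le_branching (L := L) hm)
    (branching_mul_spacing_le (L := L) hm hT hρ)

theorem blockMoran_isHomogeneous {d : ℕ} (hd : 1 ≤ d) (hm : 1 ≤ m) (hT : m < T)
    (hρ : ρ = 2 ^ (-T)) : (blockMoran hd L hm hT hρ).IsHomogeneous :=
  axisMoran_isHomogeneous hd _ _ _ _

theorem hasGrowth_limitSet_blockMoran {d : ℕ} (hd : 1 ≤ d) (hm : 1 ≤ m) (hT : m < T)
    (hρ : ρ = 2 ^ (-T)) :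
    HasGrowth (blockMoran hd L hm hT hρ).limitSet ρ (blockSum L m) where
  exists_cover k hk := by
    have hcard : Fintype.card (MoranWord (fun k => 2 ^ blockWeight L m k) k) =
        2 ^ blockSum L m k := by
      rw [card_moranWord, Finset.prod_pow_eq_pow_sum, blockSum]
    refine ⟨fun i => wordCenter ρ (2 * (1 - ρ) / ((2 : ℝ) ^ m - 1))
      ((Fintype.equivFinOfCardEq hcard).symm i) • axisVector hd, ?_⟩
    refine (limitSet_axisMoran_subset hd _ _ _ _ hk).trans (iUnion_subset fun u => ?_)
    refine subset_iUnion_of_subset (Fintype.equivFinOfCardEq hcard u) ?_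
    simp only [Equiv.symm_apply_apply, subset_refl]
  exists_mass := by
    obtain ⟨μ, hμ, h⟩ := exists_mass_distribution hd (rho_pos hρ) (two_mul_lt_spacing hm hT hρ)
      (two_le_branching (L := L) hm) (branching_mul_spacing_le (L := L) hm hT hρ)
    refine ⟨_, sub_pos.2 (two_mul_lt_spacing hm hT hρ), μ, hμ, fun k U hU =>
      (h k U hU).trans_eq ?_⟩
    have h1 : ∀ j, (((2 ^ blockWeight L m j : ℕ) : ℝ≥0∞))⁻¹ =
        ENNReal.ofReal (((2 : ℝ) ^ blockWeight L m j)⁻¹) := fun j => by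
      rw [ENNReal.ofReal_inv_of_pos (by positivity), ENNReal.ofReal_pow two_pos.le]
      simp
    simp_rw [h1]
    rw [← ENNReal.ofReal_prod_of_nonneg (fun _ _ => by positivity), Finset.prod_inv_distrib,
      Finset.prod_pow_eq_pow_sum, blockSum]

theorem blockExponent_pos {θ : ℝ} (hθ : 0 ≤ θ) : 0 < blockExponent L m θ := by
  unfold blockExponent; positivity

theorem tendsto_blockSum (hm : 1 ≤ m) : Tendsto (blockSum L m) atTop atTop := by
  refine tendsto_atTop_mono (fun k => ?_) tendsto_id
  have := blockSum_add_sub_le (L := L) hm k.zero_le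
  simp only [Nat.cast_zero, sub_zero] at this
  have h0 : (0 : ℝ) ≤ blockSum L m 0 := Nat.cast_nonneg _
  exact_mod_cast (by linarith : (k : ℝ) ≤ blockSum L m k)

/-- The critical windows recur around every odd power of L, so their left ends x are unbounded, with
the same error m e each time. -/
theorem exists_window_le_blockSum (hL : 2 ≤ L) (hm : 1 ≤ m) {θ : ℝ} (hθ : 0 < θ) {e : ℝ}
    (he : 0 ≤ e) :
    ∃ A : ℝ, ∀ x₀ : ℝ, ∃ x, x₀ ≤ x ∧ ∀ k : ℕ, x - e ≤ k → k * θ ≤ x →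
      blockExponent L m θ * k - A ≤ blockSum L m k := by
  refine ⟨m * e, fun x₀ => ?_⟩
  have hD : (0 : ℝ) < (L : ℝ) + 1 := by positivity
  obtain ⟨j, hj⟩ := exists_nat_ge (x₀ * (L + 1))
  have h1 : (j : ℝ) ≤ (L : ℝ) ^ (2 * j + 1) := by
    have : j ≤ L ^ (2 * j + 1) :=
      (Nat.lt_pow_self (by omega)).le.trans (Nat.pow_le_pow_right (by omega) (by omega))
    exact_mod_cast this
  refine ⟨(L : ℝ) ^ (2 * j + 1) * (1 + L * θ) / (L + 1), ?_, fun k hk1 hk2 =>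
    le_blockSum_of_mem hL hm hθ he (mul_div_cancel₀ _ hD.ne') hk1 hk2⟩
  rw [le_div_iff₀ hD]
  have : (0 : ℝ) ≤ (L : ℝ) ^ (2 * j + 1) * (L * θ) := by positivity
  linarith

end BlockMoran

end

theorem proposition1p5 (d : ℕ) (hd : 1 ≤ d) (L : ℕ) (hL : 2 ≤ L)
    (f : ℝ → ℝ) (hf : f ∈ moebiusFamily L) :
    ∃ E : Set (EuclideanSpace ℝ (Fin d)), IsHomogeneousMoranSet E ∧
      (∀ θ ∈ Set.Icc (1 / (L : ℝ) ^ 2) 1,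
        upperIntermediateDim θ E = ENNReal.ofReal (f θ)) ∧
      (∀ θ ∈ Set.Icc (0 : ℝ) (1 / (L : ℝ) ^ 2),
        upperIntermediateDim θ E = dimH E) ∧
      (∀ θ ∈ Set.Icc (0 : ℝ) 1, lowerIntermediateDim θ E = dimH E) := by
  obtain ⟨a, b, c, hac, hba, hb, ⟨m, hm⟩, rfl⟩ := hf
  -- Dividing numerator and denominator by b leaves only the integer m and the real T = c/b; then f
  -- is `blockExponent` divided by T.
  obtain rfl : a = m * b := (div_eq_iff hb.ne').1 hm
  have hm1 : 1 ≤ m := by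
    have : (1 : ℝ) ≤ m := by nlinarith
    exact_mod_cast this
  obtain ⟨T, rfl⟩ : ∃ T, c = T * b := ⟨c / b, (div_mul_cancel₀ c hb.ne').symm⟩
  have hT : (m : ℝ) < T := lt_of_mul_lt_mul_right hac hb.le
  have hT0 : 0 < T := (Nat.cast_nonneg m).trans_lt hT
  have hL0 : (0 : ℝ) < L := by exact_mod_cast (by omega : 0 < L)
  have hθ₀ : (0 : ℝ) < 1 / (L : ℝ) ^ 2 := by positivity
  have hθ₁ : 1 / (L : ℝ) ^ 2 ≤ 1 := by
    have : (1 : ℝ) ≤ L := by exact_mod_cast (by omega : 1 ≤ L)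
    exact (div_le_one (by positivity)).2 (one_le_pow₀ this)
  have : Nonempty (Fin d) := ⟨⟨0, hd⟩⟩
  have hG := hasGrowth_limitSet_blockMoran (L := L) hd hm1 hT rfl
  set E := (blockMoran hd L hm1 hT rfl).limitSet
  have hlower : ∀ θ ∈ Icc (0 : ℝ) 1, lowerIntermediateDim θ E ≤
      ENNReal.ofReal (blockExponent L m (1 / (L : ℝ) ^ 2) / T) := fun θ hθ =>
    hG.lowerIntermediateDim_le hT0 rfl hθ.1 hθ.2 fun k => ⟨L ^ (2 * k),
      (Nat.lt_pow_self (by omega)).le.trans (Nat.pow_le_pow_right (by omega) (by omega)),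
      blockSum_even_le hL hm1 k⟩
  -- The covers at even powers of L bound the dimension above, and the global lower bound on
  -- `blockSum` bounds it below; the choice θ = 1 is arbitrary.
  have hdim : dimH E = ENNReal.ofReal (blockExponent L m (1 / (L : ℝ) ^ 2) / T) :=
    le_antisymm ((dimH_le_lowerIntermediateDim 1 E).trans (hlower 1 ⟨zero_le_one, le_rfl⟩))
      (hG.le_dimH hT0 rfl (blockExponent_pos hθ₀.le) (tendsto_blockSum hm1) (le_blockSum hL hm1))
  refine ⟨E, ⟨_, blockMoran_isHomogeneous hd hm1 hT rfl, rfl⟩, fun θ hθ => ?_, fun θ hθ => ?_,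
    fun θ hθ => ?_⟩
  · have hθ0 : 0 < θ := hθ₀.trans_le hθ.1
    have hf : (L * (m * b) * θ + b) / (L * (T * b) * θ + T * b) = blockExponent L m θ / T := by
      have : (0 : ℝ) < L * θ + 1 := by positivity
      rw [blockExponent, div_div, div_eq_div_iff (by positivity) (by positivity)]
      ring
    change _ = ENNReal.ofReal ((L * (m * b) * θ + b) / (L * (T * b) * θ + T * b))
    rw [hf]
    exact le_antisymm
      (hG.upperIntermediateDim_le hT0 rfl hθ0.le hθ.2 fun k hk =>
        exists_blockSum_le hL hm1 hθ.1 hθ.2 hk)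
      (hG.le_upperIntermediateDim hT0 rfl (blockExponent_pos hθ0.le) (tendsto_blockSum hm1) hθ0
        fun e he => exists_window_le_blockSum hL hm1 hθ0 he)
  · refine le_antisymm ?_ ((dimH_le_lowerIntermediateDim θ E).trans
      (lowerIntermediateDim_le_upperIntermediateDim θ E))
    rw [hdim]
    refine hG.upperIntermediateDim_le (A := m) hT0 rfl hθ.1 (hθ.2.trans hθ₁) fun k hk => ?_
    obtain ⟨j, h1, h2⟩ := exists_even_pow hL hk hθ.2
    exact ⟨_, h1, h2, blockSum_even_le hL hm1 j⟩
  · exact le_antisymm ((hlower θ hθ).trans_eq hdim.symm) (dimH_le_lowerIntermediateDim θ E)
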